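/- Two robots $R_1,R_2$ start at the center $O$ of the closed unit disk and move at speed at most $1$. An exit is located at an unknown point $E$ of the boundary circle. A robot notices the exit only when it stands on it, and the robots can exchange information only when they are at the same point. For parameters $p_1,\alpha_1,d_1,p_2,\alpha_2,d_2$, the algorithm $\mathrm{Alg}(p_1,\alpha_1,d_1,p_2,\alpha_2,d_2)$ is the following. As long as no exit information reaches them, both robots move at unit speed on the following trajectories. 1. Both move on a straight line from $O$ to an arbitrary boundary point $I$. 2. From $I$ they move along the boundary, $R_1$ counter-clockwise and $R_2$ clockwise, until each has covered the distance $p_1$ on the boundary; $R_1$ is then at $C_1$ and $R_2$ at $C_1'$. 3. First cut: each moves distance $d_1$ on a straight line into the disk and returns on the same line to $C_1$, respectively $C_1'$. The line makes the angle $\alpha_1$ with the chord $C_1C_1'$ and is directed towards the other robot's side, on the side of the chord that contains $I$. 4. They continue along the boundary in their respective directions until each has covered the distance $p_2$ on the boundary in total (cuts not counted); $R_1$ is then at $C_2$ and $R_2$ at $C_2'$. 5. Second cut: as in step 3, with $C_2,C_2',\alpha_2,d_2$ in place of $C_1,C_1',\alpha_1,d_1$. 6. They continue along the boundary in their respective directions.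 Suppose the exit $E$ is first found at time $t_0$, by one of the robots. Let $t\ge 0$ be the shortest additional time such that the other robot's trajectory is, at time $t_0+t$, at a point $M$ with $|\overline{EM}|=t$. The robot that found the exit moves at unit speed along the segment $\overline{EM}$ and picks up the other robot at $M$ at time $t_0+t$, and both then move together at unit speed along $\overline{ME}$ to $E$ and stay there. **Theorem.** Let $$p_1^*=2.62666582851,\quad \alpha_1^*=\tfrac{2\pi}{9},\quad d_1^*=0.490011696287,$$ $$p_2^*=2.97374843355,\quad \alpha_2^*=0.05523991\,\pi,\quad d_2^*=0.1670474016.$$ For every choice of the starting point $I$ on the boundary and every exit position $E$ on the boundary of the closed unit disk, $\mathrm{Alg}(p_1^*,\alpha_1^*,d_1^*,p_2^*,\alpha_2^*,d_2^*)$ evacuates both robots within time at most $5.6234$. That is, the exit is found, the meeting point exists, and from time $5.6234$ on both robots are at $E$. -/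

import Mathlib

namespace DiskEvacuation

/-- The two robots `R₁` (searching counter-clockwise) and `R₂` (searching clockwise). -/
inductive Robot where
  | R1
  | R2

/-- The other robot. -/
def Robot.other : Robot → Robot
  | .R1 => .R2
  | .R2 => .R1

/-- Parameters of the two-cut algorithm: the position `p`, the angle `α` and the depth `d`
of the first and of the second cut. -/
structure CutParams where
  p₁ : ℝ
  α₁ : ℝ
  d₁ : ℝ
  p₂ : ℝ
  α₂ : ℝ
  d₂ : ℝ

noncomputable section

/-- The point of the unit circle reached from `1` after travelling distance `x`
counter-clockwise along the circle. -/
def arcPoint (x : ℝ) : ℂ := Complex.exp (x * Complex.I)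

/-- The unit vector in which the counter-clockwise robot enters a cut of angle `α`, in coordinates
where `I = 1`.  The robots then stand at the mirror points `C = arcPoint p` and `C' = conj C`.
The chord from `C` to `C'` points in direction `-i` (for `0 < p < π`), and the cut makes the
angle `α` with this chord, on the side of the chord on which `I` lies. -/
def cutDir (α : ℝ) : ℂ := Real.sin α - Real.cos α * Complex.I

/-- Position at time `s` of the counter-clockwise robot as long as it knows nothing about the exit,
in coordinates where the disk is the unit disk of `ℂ` and `I = 1`.  The robot moves at unit speed:
from the centre to `I`; along the circle up to arc length `p₁`; along the first cut to its
tip at distance `d₁` and back; along the circle up to total arc length `p₂`; along the second cut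
to its tip at distance `d₂` and back; and on along the circle. -/
def basePath (P : CutParams) (s : ℝ) : ℂ :=
  if s ≤ 1 then (s : ℂ)
  else if s ≤ 1 + P.p₁ then arcPoint (s - 1)
  else if s ≤ 1 + P.p₁ + P.d₁ then
    arcPoint P.p₁ + ((s - (1 + P.p₁) : ℝ) : ℂ) * cutDir P.α₁
  else if s ≤ 1 + P.p₁ + 2 * P.d₁ then
    arcPoint P.p₁ + ((1 + P.p₁ + 2 * P.d₁ - s : ℝ) : ℂ) * cutDir P.α₁
  else if s ≤ 1 + P.p₂ + 2 * P.d₁ then arcPoint (s - 1 - 2 * P.d₁)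
  else if s ≤ 1 + P.p₂ + 2 * P.d₁ + P.d₂ then
    arcPoint P.p₂ + ((s - (1 + P.p₂ + 2 * P.d₁) : ℝ) : ℂ) * cutDir P.α₂
  else if s ≤ 1 + P.p₂ + 2 * P.d₁ + 2 * P.d₂ then
    arcPoint P.p₂ + ((1 + P.p₂ + 2 * P.d₁ + 2 * P.d₂ - s : ℝ) : ℂ) * cutDir P.α₂
  else arcPoint (s - 1 - 2 * P.d₁ - 2 * P.d₂)

/-- Search trajectory of each robot when the search starts at the boundary point `u`
(the point `I` of the algorithm): the trajectories are mirror images of each other in the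
diameter through `u`. -/
def searchPath (P : CutParams) (u : ℂ) : Robot → ℝ → ℂ
  | .R1, s => u * basePath P s
  | .R2, s => u * (starRingEnd ℂ) (basePath P s)

/-- With the exit at `E`, the exit is discovered for the first time at time `t₀`, by robot `f`, and
`t` is the shortest additional time for which the other robot, at time `t₀ + t`, is at
distance exactly `t` from `E` (the meeting protocol). -/
structure IsMeeting (P : CutParams) (u E : ℂ) (f : Robot) (t₀ t : ℝ) : Prop where
  first_discovery : IsLeast {s : ℝ | 0 ≤ s ∧ ∃ r, searchPath P u r s = E} t₀
  found : searchPath P u f t₀ = E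
  pickup : IsLeast {τ : ℝ | 0 ≤ τ ∧ dist E (searchPath P u f.other (t₀ + τ)) = τ} t

/-- Position, at time `τ` after leaving `E`, on the trip at unit speed from `E` straight to `M`
and straight back to `E`, where `t` is the distance of `E` and `M`; the trip ends in `E`. -/
def roundTrip (E M : ℂ) (t τ : ℝ) : ℂ :=
  if τ ≤ t then E + ((τ / t : ℝ) : ℂ) * (M - E)
  else if τ ≤ 2 * t then M + (((τ - t) / t : ℝ) : ℂ) * (E - M)
  else E

/-- Actual position at time `s` of the robot `f` that discovers the exit `E` at time `t₀` and meets
its partner at time `t₀ + t`. -/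
def finderPos (P : CutParams) (u E : ℂ) (f : Robot) (t₀ t s : ℝ) : ℂ :=
  if s ≤ t₀ then searchPath P u f s
  else roundTrip E (searchPath P u f.other (t₀ + t)) t (s - t₀)

/-- Actual position at time `s` of the partner of the finder `f`: it follows its search
trajectory until it is picked up at time `t₀ + t`, and then travels with the finder to `E`. -/
def partnerPos (P : CutParams) (u E : ℂ) (f : Robot) (t₀ t s : ℝ) : ℂ :=
  if s ≤ t₀ + t then searchPath P u f.other s
  else roundTrip E (searchPath P u f.other (t₀ + t)) t (s - t₀)

/-- With starting point `u` of the search and exit `E`, the two-cut algorithm evacuates both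
robots within time `T`: the exit is discovered, the robots meet, and from time `T` on both robots
are at the exit. -/
def EvacuatesWithin (P : CutParams) (u E : ℂ) (T : ℝ) : Prop :=
  (∃ f t₀ t, IsMeeting P u E f t₀ t) ∧
    ∀ f t₀ t, IsMeeting P u E f t₀ t →
      ∀ s, T ≤ s → finderPos P u E f t₀ t s = E ∧ partnerPos P u E f t₀ t s = E

/-- The parameter values `p₁*, α₁*, d₁*, p₂*, α₂*, d₂*`. -/
def starParams : CutParams where
  p₁ := 2.62666582851
  α₁ := 2 * Real.pi / 9
  d₁ := 0.490011696287
  p₂ := 2.97374843355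
  α₂ := 0.05523991 * Real.pi
  d₂ := 0.1670474016

end

end DiskEvacuation

/-!
Let `t₀` be the time of the first discovery of the exit. The partner moves continuously, so by the
intermediate value theorem it suffices that at time `t₀ + τ`, with `τ = (5.6234 - t₀) / 2`, the
partner is within distance `τ` of the exit (`exists_pickup`): then the robots meet within additional
time `t ≤ τ`, and the round trip of the finder ends at time `t₀ + 2 t ≤ 5.6234`. This reduction is
`evacuatesWithin_of_dist_le`. Rotating the disk and reflecting it in the diameter through the starting
point, one may assume that the finder is the counter-clockwise robot and starts at `1`.

The cuts are shorter than the chords on their lines, so the exit is found on one of the three arcs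
(`arc_phase_of_norm_basePath_eq_one`), at an arc length `x ∈ [0, π]`. At time `(5.6234 + t₀) / 2` the
partner is on an arc, or at depth `r` in a cut `(p, α)`. In the first case, at arc length `y`, the
squared distance is `2 - 2 cos (x + y)`; in the second case it is
`2 - 2 cos (x + p) - 2 r (sin (x + α) + sin (p - α)) + r ^ 2`. As `y` and `r` are affine in `x`, the
claim becomes eight inequalities in the single real variable `x`, the `meeting_ineq_*` lemmas. The
parameters nearly balance the critical exits, just before or after which the partner enters or
leaves a cut or the finder resumes its search, so the slack there is as small as `4 * 10⁻⁷`. It is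
positive at the critical end of each range by Taylor bounds for sine and cosine
(`taylor_cos_sin_alternating`), and it stays so because there it grows linearly into the range.
-/

namespace DiskEvacuation

open Real

/-! ### Alternating Taylor bounds for sine and cosine -/

/-- The Taylor polynomials of `cos` and `sin` at `0` are alternately upper and lower bounds on
`[0, ∞)`. Each bound follows from the preceding one by integration. -/
theorem taylor_cos_sin_alternating (n : ℕ) :
    (∀ x : ℝ, 0 ≤ x → 0 ≤ (-1) ^ (n + 1) *
      (cos x - ∑ k ∈ Finset.range (n + 1), (-1) ^ k * x ^ (2 * k) / (2 * k).factorial)) ∧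
    (∀ x : ℝ, 0 ≤ x → 0 ≤ (-1) ^ (n + 1) *
      (sin x - ∑ k ∈ Finset.range (n + 1), (-1) ^ k * x ^ (2 * k + 1) / (2 * k + 1).factorial)) := by
  have mono : ∀ f f' : ℝ → ℝ, (∀ x, HasDerivAt f (f' x) x) → f 0 = 0 →
      (∀ x, 0 ≤ x → 0 ≤ f' x) → ∀ x, 0 ≤ x → 0 ≤ f x := by
    intro f f' hd h0 hf' x hx
    have : MonotoneOn f (Set.Ici 0) := by
      apply monotoneOn_of_deriv_nonneg (convex_Ici 0)
      · exact fun y _ => (hd y).continuousAt.continuousWithinAt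
      · exact fun y _ => (hd y).differentiableAt.differentiableWithinAt
      · intro y hy
        rw [interior_Ici] at hy
        rw [(hd y).deriv]
        exact hf' y (le_of_lt hy)
    simpa [h0] using this (Set.mem_Ici.2 le_rfl) (Set.mem_Ici.2 hx) hx
  have dpow : ∀ (m : ℕ) (s x : ℝ), HasDerivAt (fun x : ℝ => s * x ^ (m + 1) / (m + 1).factorial)
      (s * x ^ m / m.factorial) x := by
    intro m s x
    have h := ((hasDerivAt_pow (m + 1) x).const_mul s).div_const ((m + 1).factorial : ℝ)
    refine h.congr_deriv ?_
    rw [Nat.factorial_succ]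
    have : (m.factorial : ℝ) ≠ 0 := by positivity
    have : ((m : ℝ) + 1) ≠ 0 := by positivity
    push_cast
    field_simp
  have step : ∀ n : ℕ, (∀ x : ℝ, 0 ≤ x → 0 ≤ (-1) ^ (n + 1) *
      (cos x - ∑ k ∈ Finset.range (n + 1), (-1) ^ k * x ^ (2 * k) / (2 * k).factorial)) →
      (∀ x : ℝ, 0 ≤ x → 0 ≤ (-1) ^ (n + 1) * (sin x -
        ∑ k ∈ Finset.range (n + 1), (-1) ^ k * x ^ (2 * k + 1) / (2 * k + 1).factorial)) := by
    intro n h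
    refine mono _ _ (fun x => ?_) ?_ h
    · refine ((hasDerivAt_sin x).fun_sub (HasDerivAt.fun_sum fun k _ => ?_)).const_mul _
      exact dpow (2 * k) _ x
    · simp
  induction n with
  | zero =>
    have h : ∀ x : ℝ, 0 ≤ x → 0 ≤ (-1) ^ (0 + 1) * (cos x -
        ∑ k ∈ Finset.range (0 + 1), (-1) ^ k * x ^ (2 * k) / (2 * k).factorial) := by
      intro x _
      simpa using cos_le_one x
    exact ⟨h, step 0 h⟩
  | succ n ih =>
    have h : ∀ x : ℝ, 0 ≤ x → 0 ≤ (-1) ^ (n + 1 + 1) * (cos x -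
        ∑ k ∈ Finset.range (n + 1 + 1), (-1) ^ k * x ^ (2 * k) / (2 * k).factorial) := by
      refine mono _ (fun x => (-1) ^ (n + 1) * (sin x -
        ∑ k ∈ Finset.range (n + 1), (-1) ^ k * x ^ (2 * k + 1) / (2 * k + 1).factorial))
        (fun x => ?_) ?_ ih.2
      · have hsum : HasDerivAt (fun x : ℝ => ∑ k ∈ Finset.range (n + 1 + 1),
            (-1) ^ k * x ^ (2 * k) / (2 * k).factorial)
            (∑ k ∈ Finset.range (n + 1), (-1) ^ (k + 1) * x ^ (2 * k + 1) / (2 * k + 1).factorial)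
            x := by
          simp only [Finset.sum_range_succ' _ (n + 1), mul_zero, pow_zero]
          refine HasDerivAt.add_const _ (HasDerivAt.fun_sum fun k _ => dpow (2 * k + 1) _ x)
        refine (((hasDerivAt_cos x).fun_sub hsum).const_mul _).congr_deriv ?_
        have : ∑ k ∈ Finset.range (n + 1), (-1) ^ (k + 1) * x ^ (2 * k + 1) /
            ((2 * k + 1).factorial : ℝ) = -∑ k ∈ Finset.range (n + 1),
              (-1) ^ k * x ^ (2 * k + 1) / ((2 * k + 1).factorial : ℝ) := by
          rw [← Finset.sum_neg_distrib]
          exact Finset.sum_congr rfl fun k _ => by ring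
        rw [this]
        ring
      · simp [Finset.sum_range_succ']
    exact ⟨h, step _ h⟩

theorem cos_le_quartic {x : ℝ} (hx : 0 ≤ x) : cos x ≤ 1 - x ^ 2 / 2 + x ^ 4 / 24 := by
  have := (taylor_cos_sin_alternating 2).1 x hx
  simp [Finset.sum_range_succ, Nat.factorial] at this
  linarith

theorem sin_le_quintic {x : ℝ} (hx : 0 ≤ x) : sin x ≤ x - x ^ 3 / 6 + x ^ 5 / 120 := by
  have := (taylor_cos_sin_alternating 2).2 x hx
  simp [Finset.sum_range_succ, Nat.factorial] at this
  linarith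

theorem decic_le_cos {x : ℝ} (hx : 0 ≤ x) :
    1 - x ^ 2 / 2 + x ^ 4 / 24 - x ^ 6 / 720 + x ^ 8 / 40320 - x ^ 10 / 3628800 ≤ cos x := by
  have := (taylor_cos_sin_alternating 5).1 x hx
  simp [Finset.sum_range_succ, Nat.factorial] at this
  linarith

theorem sextic_le_cos {x : ℝ} (hx : 0 ≤ x) :
    1 - x ^ 2 / 2 + x ^ 4 / 24 - x ^ 6 / 720 ≤ cos x := by
  have := (taylor_cos_sin_alternating 3).1 x hx
  simp [Finset.sum_range_succ, Nat.factorial] at this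
  linarith

/-! ### Chord against flight time -/

/-!
The finder discovers the exit at arc length `x`, at a time `t₀`. The left-hand sides below are the
squared distance of the exit from the partner at time `(5.6234 + t₀) / 2`, the right-hand sides are
the square of `(5.6234 - t₀) / 2`. There is one inequality for each combination of phases; the
ends of the range of `x` are the values where one of the robots changes its phase. The decimals
are the sums of the parameters that mark the phases, such as `3.62666582851 = 1 + p₁`,
`4.606689221084 = 1 + p₁ + 2 d₁`, `4.953771826124 = 1 + p₂ + 2 d₁`,
`5.287866629324 = 1 + p₂ + 2 d₁ + 2 d₂`, `7.603423392574 = 5.6234 + 1 + 2 d₁`,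
`2.314118195774 = 1 + 2 d₁ + 2 d₂`. -/

theorem le_sin_first_cut : 0.936 ≤ sin (2.62666582851 - 2 * π / 9) := by
  have hp := pi_gt_d20
  have hp' := pi_lt_d20
  rw [← cos_pi_div_two_sub]
  refine le_trans ?_ one_sub_sq_div_two_le_cos
  nlinarith

theorem le_sin_second_cut : 0.334753 ≤ sin (2.97374843355 - 0.05523991 * π) := by
  have hp := pi_gt_d20
  have hp' := pi_lt_d20
  rw [← sin_pi_sub]
  have h : sin 0.3413855 ≤ sin (π - (2.97374843355 - 0.05523991 * π)) :=
    sin_le_sin_of_le_of_le_pi_div_two (by linarith) (by linarith) (by linarith)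
  exact (le_trans (by norm_num) (sin_ge_sub_cube (by norm_num))).trans h

/-- Finder before the first cut, partner on the arc before the first cut. For `x ≤ 0.6234` the flight
time is at least the diameter `2`; beyond that, the cosine is expanded at the antipodal
position. -/
theorem meeting_ineq_early_arc {x : ℝ} (h₀ : 0 ≤ x) (h₁ : x ≤ 0.62993165702) :
    2 - 2 * cos (x + (4.6234 + x) / 2) ≤ ((4.6234 - x) / 2) ^ 2 := by
  have hp := pi_gt_d20
  have hp' := pi_lt_d20
  rcases le_total x 0.6234 with h | h
  · nlinarith [neg_one_le_cos (x + (4.6234 + x) / 2)]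
  · have e : cos (x + (4.6234 + x) / 2) = -cos (x + (4.6234 + x) / 2 - π) := by
      rw [cos_sub_pi, neg_neg]
    have h₂ : cos (x + (4.6234 + x) / 2 - π) ≤ cos (1.5 * x - 0.82989266) :=
      cos_le_cos_of_nonneg_of_le_pi (by linarith) (by linarith) (by linarith)
    have h₃ := cos_le_quartic (x := 1.5 * x - 0.82989266) (by linarith)
    have h₄ : (1.5 * x - 0.82989266) ^ 2 ≤ 0.0134 := by nlinarith
    rw [e]
    nlinarith [mul_nonneg (sub_nonneg.2 h₄) (sq_nonneg (1.5 * x - 0.82989266))]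

/-- Finder before the first cut, partner on its way into the first cut. The depth `r` of the partner
is half of `z = x - 0.62993165702` and `((4.6234 - x) / 2) ^ 2 - r ^ 2` is affine in `z`; the slack
is smallest at `z = 0`. -/
theorem meeting_ineq_first_cut_in {x : ℝ} (h₀ : 0.62993165702 ≤ x) (h₁ : x ≤ 1.6099550495940) :
    2 - 2 * cos (x + 2.62666582851) - 2 * ((5.6234 + (1 + x)) / 2 - 3.62666582851) *
      (sin (x + 2 * π / 9) + sin (2.62666582851 - 2 * π / 9)) +
      ((5.6234 + (1 + x)) / 2 - 3.62666582851) ^ 2 ≤ ((4.6234 - x) / 2) ^ 2 := by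
  have hp := pi_gt_d20
  have hp' := pi_lt_d20
  obtain ⟨z, rfl⟩ : ∃ z, x = 0.62993165702 + z := ⟨x - 0.62993165702, by ring⟩
  have hz : 0 ≤ z := by linarith
  have hz' : z ≤ 0.9801 := by linarith
  have hc : -(1 - (z + 0.1150048) ^ 2 / 2 + (z + 0.1150048) ^ 4 / 24) ≤
      cos (0.62993165702 + z + 2.62666582851) := by
    have e : cos (0.62993165702 + z + 2.62666582851) =
      -cos (0.62993165702 + z + 2.62666582851 - π) := by rw [cos_sub_pi, neg_neg]
    have h₂ : cos (0.62993165702 + z + 2.62666582851 - π) ≤ cos (z + 0.1150048) :=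
      cos_le_cos_of_nonneg_of_le_pi (by linarith) (by linarith) (by linarith)
    have h₃ := cos_le_quartic (x := z + 0.1150048) (by linarith)
    linarith
  have hs : 0.999 - (z - 0.2427) ^ 2 / 2 ≤ sin (0.62993165702 + z + 2 * π / 9) := by
    rw [← cos_pi_div_two_sub]
    refine le_trans ?_ one_sub_sq_div_two_le_cos
    have : |π / 2 - (0.62993165702 + z + 2 * π / 9) + (z - 0.2427)| ≤ 0.0001 := by
      rw [abs_le]; constructor <;> linarith
    rw [abs_le] at this
    nlinarith
  have hS := le_sin_first_cut
  have hm := mul_le_mul_of_nonneg_left (add_le_add hs hS) hz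
  -- polynomial lower bound for the growth of the slack from the end `z = 0`
  have hpoly : 0 ≤ z * (0.1 + z * (1.2 - 0.6 * z) - z ^ 3 / 12) := by
    apply mul_nonneg hz
    nlinarith [mul_nonneg hz (sub_nonneg.2 hz'), mul_nonneg (mul_nonneg hz hz) (sub_nonneg.2 hz')]
  nlinarith

/-- Finder before the first cut, partner on its way out of the first cut. The depth of the partner
is half of `z = 2.589978442168 - x`. The slack at `z = 0` is about `10⁻⁵`, and its
first- and second-order coefficients there are positive. -/
theorem meeting_ineq_first_cut_out {x : ℝ} (h₀ : 1.6099550495940 ≤ x) (h₁ : x ≤ 2.589978442168) :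
    2 - 2 * cos (x + 2.62666582851) - 2 * (4.606689221084 - (5.6234 + (1 + x)) / 2) *
      (sin (x + 2 * π / 9) + sin (2.62666582851 - 2 * π / 9)) +
      (4.606689221084 - (5.6234 + (1 + x)) / 2) ^ 2 ≤ ((4.6234 - x) / 2) ^ 2 := by
  have hp := pi_gt_d20
  have hp' := pi_lt_d20
  obtain ⟨z, rfl⟩ : ∃ z, x = 2.589978442168 - z := ⟨2.589978442168 - x, by ring⟩
  have hz : 0 ≤ z := by linarith
  have hz' : z ≤ 0.9801 := by linarith
  have hS := le_sin_first_cut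
  -- `2π` minus the angle at the critical end `z = 0` of the range
  have hc : 0.48315 ≤ cos (2 * π - 5.216644270678) := by
    have h₂ : cos 1.066541036502 ≤ cos (2 * π - 5.216644270678) :=
      cos_le_cos_of_nonneg_of_le_pi (by linarith) (by linarith) (by linarith)
    exact (le_trans (by norm_num) (decic_le_cos (by norm_num))).trans h₂
  have hs : sin (2 * π - 5.216644270678) ≤ 0.8761 := by
    have h₂ : sin (2 * π - 5.216644270678) ≤ sin 1.066541036503 :=
      sin_le_sin_of_le_of_le_pi_div_two (by linarith) (by linarith) (by linarith)
    exact h₂.trans ((sin_le_quintic (by norm_num)).trans (by norm_num))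
  have hz₁ : sin z ≤ z := sin_le hz
  have hz₂ : 0 ≤ sin z := sin_nonneg_of_nonneg_of_le_pi hz (by linarith)
  have hz₃ : 1 - z ^ 2 / 2 ≤ cos z := one_sub_sq_div_two_le_cos
  have hz₄ : z - z ^ 3 / 6 ≤ sin z := sin_ge_sub_cube hz
  have hsq : 0 ≤ 1 - z ^ 2 / 2 := by nlinarith
  have hcos : 0.48315 * (1 - z ^ 2 / 2) - 0.8761 * z ≤
      cos (2.589978442168 - z + 2.62666582851) := by
    have e : cos (2.589978442168 - z + 2.62666582851) =
        cos (2 * π - 5.216644270678) * cos z - sin (2 * π - 5.216644270678) * sin z := by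
      rw [← cos_add, ← cos_two_pi_sub]
      congr 1; ring
    rw [e]
    have := mul_le_mul hc hz₃ hsq (by linarith)
    nlinarith
  have hsin : 0.98 * (z - z ^ 3 / 6) - 0.14652 ≤ sin (2.589978442168 - z + 2 * π / 9) := by
    have e : sin (2.589978442168 - z + 2 * π / 9) =
        sin z * cos (2.589978442168 + 2 * π / 9 - π) -
          cos z * sin (2.589978442168 + 2 * π / 9 - π) := by
      rw [← sin_sub, ← sin_pi_sub]
      congr 1; ring
    have h₂ : 0.98 ≤ cos (2.589978442168 + 2 * π / 9 - π) := by
      refine le_trans ?_ one_sub_sq_div_two_le_cos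
      nlinarith
    have h₃ : sin (2.589978442168 + 2 * π / 9 - π) ≤ 0.14652 :=
      (sin_le (by linarith)).trans (by linarith)
    have h₄ : 0 ≤ sin (2.589978442168 + 2 * π / 9 - π) :=
      sin_nonneg_of_nonneg_of_le_pi (by linarith) (by linarith)
    rw [e]
    nlinarith [cos_le_one z]
  have hm := mul_le_mul_of_nonneg_left (add_le_add hsin hS) hz
  -- polynomial lower bound for the growth of the slack from the end `z = 0`
  have hpoly : 0 ≤ z * (0.05 + 0.49 * z - 0.164 * z ^ 3) := by
    apply mul_nonneg hz
    nlinarith [mul_nonneg hz (sub_nonneg.2 hz'), mul_nonneg (mul_nonneg hz hz) (sub_nonneg.2 hz')]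
  nlinarith

/-- Finder before the first cut, partner on the arc between the cuts. The slack is smallest at the
left end, where the partner leaves the first cut. -/
theorem meeting_ineq_middle_arc {x : ℝ} (h₀ : 2.589978442168 ≤ x) (h₁ : x ≤ 2.62666582851) :
    2 - 2 * cos (x + ((5.6234 + (1 + x)) / 2 - 1 - 2 * 0.490011696287)) ≤
      ((4.6234 - x) / 2) ^ 2 := by
  have hp := pi_gt_d20
  have hp' := pi_lt_d20
  obtain ⟨z, rfl⟩ : ∃ z, x = 2.589978442168 + z := ⟨x - 2.589978442168, by ring⟩
  have hz : 0 ≤ z := by linarith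
  have hz' : z ≤ 0.0367 := by linarith
  have hc : 0.48315 + z ≤ cos (1.066541036502 - 1.5 * z) := by
    have h₃ : 0.48315 ≤ cos 1.066541036502 :=
      le_trans (by norm_num) (decic_le_cos (by norm_num))
    have h₄ : 0.86 ≤ sin 1.066541036502 := le_trans (by norm_num) (sin_ge_sub_cube (by norm_num))
    have h₅ : 1 - (1.5 * z) ^ 2 / 2 ≤ cos (1.5 * z) := one_sub_sq_div_two_le_cos
    have h₆ : 1.5 * z - (1.5 * z) ^ 3 / 6 ≤ sin (1.5 * z) := sin_ge_sub_cube (by linarith)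
    have h₇ : cos 1.066541036502 ≤ 1 := cos_le_one _
    rw [cos_sub]
    have h₈ : 0.9 * (1.5 * z) ≤ sin (1.5 * z) := by nlinarith
    have h₉ := mul_le_mul h₄ h₈ (by linarith) (by linarith)
    nlinarith
  have e : cos (2.589978442168 + z + ((5.6234 + (1 + (2.589978442168 + z))) / 2 - 1 -
      2 * 0.490011696287)) = cos (2 * π - 5.216644270678 - 1.5 * z) := by
    rw [← cos_two_pi_sub]
    congr 1; ring
  have h₂ : cos (1.066541036502 - 1.5 * z) ≤ cos (2 * π - 5.216644270678 - 1.5 * z) :=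
    cos_le_cos_of_nonneg_of_le_pi (by linarith) (by linarith) (by linarith)
  rw [e]
  nlinarith

/-- Finder between the cuts, partner on its way into the second cut. The slack is smallest at
`x = p₁`. -/
theorem meeting_ineq_second_cut_in {x : ℝ} (h₀ : 2.62666582851 ≤ x) (h₁ : x ≤ 2.638215062874) :
    2 - 2 * cos (x + 2.97374843355) - 2 * ((7.603423392574 + x) / 2 - 4.953771826124) *
      (sin (x + 0.05523991 * π) + sin (2.97374843355 - 0.05523991 * π)) +
      ((7.603423392574 + x) / 2 - 4.953771826124) ^ 2 ≤ ((3.643376607426 - x) / 2) ^ 2 := by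
  have hp := pi_gt_d20
  have hp' := pi_lt_d20
  obtain ⟨z, rfl⟩ : ∃ z, x = 2.62666582851 + z := ⟨x - 2.62666582851, by ring⟩
  have hz : 0 ≤ z := by linarith
  have hz' : z ≤ 0.01155 := by linarith
  have hc : 0.775827 + 0.61 * z ≤ cos (2.62666582851 + z + 2.97374843355) := by
    have e : cos (2.62666582851 + z + 2.97374843355) =
        cos (2 * π - 5.60041426206 - z) := by
      rw [← cos_two_pi_sub]
      congr 1; ring
    have h₂ : cos (0.682771046 - z) ≤ cos (2 * π - 5.60041426206 - z) :=
      cos_le_cos_of_nonneg_of_le_pi (by linarith) (by linarith) (by linarith)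
    have h₃ : 0.775827 ≤ cos 0.682771046 :=
      le_trans (by norm_num) (decic_le_cos (by norm_num))
    have h₄ : 0.629 ≤ sin 0.682771046 := le_trans (by norm_num) (sin_ge_sub_cube (by norm_num))
    have h₅ : 1 - z ^ 2 / 2 ≤ cos z := one_sub_sq_div_two_le_cos
    have h₆ : z - z ^ 3 / 6 ≤ sin z := sin_ge_sub_cube hz
    have h₈ : 0.99 * z ≤ sin z := by nlinarith
    have h₉ := mul_le_mul h₄ h₈ (by linarith) (by linarith)
    rw [e]
    refine le_trans ?_ h₂
    rw [cos_sub]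
    have h₁₀ := mul_le_mul h₃ h₅ (by nlinarith) (by linarith)
    nlinarith
  have hs : 0.334753 - z ≤ sin (2.62666582851 + z + 0.05523991 * π) := by
    have h₂ : 0.334753 ≤ sin (2.62666582851 + 0.05523991 * π) := by
      have h₃ : sin 0.3413855 ≤ sin (π - (2.62666582851 + 0.05523991 * π)) :=
        sin_le_sin_of_le_of_le_pi_div_two (by linarith) (by linarith) (by linarith)
      rw [← sin_pi_sub]
      exact (le_trans (by norm_num) (sin_ge_sub_cube (by norm_num))).trans h₃
    have h₄ : |sin (2.62666582851 + z + 0.05523991 * π) - sin (2.62666582851 + 0.05523991 * π)| ≤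
        |z| := by
      refine (abs_sin_sub_sin_le _ _).trans (le_of_eq ?_)
      congr 1; ring
    rw [abs_of_nonneg hz, abs_le] at h₄
    linarith
  have hS := le_sin_second_cut
  have hr : 0 ≤ 0.161272784418 + z / 2 := by linarith
  have hm := mul_le_mul_of_nonneg_left (add_le_add hs hS) hr
  nlinarith

/-- Finder between the cuts, partner on its way out of the second cut. The depth of the partner is
half of `z = 2.972309866074 - x`. At `z = 0` the slack is about `4 * 10⁻⁷`, the smallest of all
phases, and its first-order coefficient is about `0.004`; the quadratic term is positive. -/
theorem meeting_ineq_second_cut_out {x : ℝ} (h₀ : 2.638215062874 ≤ x)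
    (h₁ : x ≤ 2.972309866074) :
    2 - 2 * cos (x + 2.97374843355) - 2 * (5.287866629324 - (7.603423392574 + x) / 2) *
      (sin (x + 0.05523991 * π) + sin (2.97374843355 - 0.05523991 * π)) +
      (5.287866629324 - (7.603423392574 + x) / 2) ^ 2 ≤ ((3.643376607426 - x) / 2) ^ 2 := by
  have hp := pi_gt_d20
  have hp' := pi_lt_d20
  obtain ⟨z, rfl⟩ : ∃ z, x = 2.972309866074 - z := ⟨2.972309866074 - x, by ring⟩
  have hz : 0 ≤ z := by linarith
  have hz' : z ≤ 0.3341 := by linarith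
  have hS := le_sin_second_cut
  -- `2π` minus the angle at the critical end `z = 0` of the range
  have hc : 0.9437087 ≤ cos (2 * π - 5.946058299624) := by
    have h₂ : cos 0.3371270076 ≤ cos (2 * π - 5.946058299624) :=
      cos_le_cos_of_nonneg_of_le_pi (by linarith) (by linarith) (by linarith)
    exact (le_trans (by norm_num) (decic_le_cos (by norm_num))).trans h₂
  have hs : sin (2 * π - 5.946058299624) ≤ 0.33078 := by
    have h₂ : sin (2 * π - 5.946058299624) ≤ sin 0.3371270076 :=
      sin_le_sin_of_le_of_le_pi_div_two (by linarith) (by linarith) (by linarith)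
    exact h₂.trans ((sin_le_quintic (by norm_num)).trans (by norm_num))
  have hz₁ : sin z ≤ z := sin_le hz
  have hz₂ : 0 ≤ sin z := sin_nonneg_of_nonneg_of_le_pi hz (by linarith)
  have hz₃ : 1 - z ^ 2 / 2 ≤ cos z := one_sub_sq_div_two_le_cos
  have hz₄ : z - z ^ 3 / 6 ≤ sin z := sin_ge_sub_cube hz
  have hsq : 0 ≤ 1 - z ^ 2 / 2 := by nlinarith
  have hcos : 0.9437087 * (1 - z ^ 2 / 2) - 0.33078 * z ≤
      cos (2.972309866074 - z + 2.97374843355) := by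
    have e : cos (2.972309866074 - z + 2.97374843355) =
        cos (2 * π - 5.946058299624) * cos z - sin (2 * π - 5.946058299624) * sin z := by
      rw [← cos_add, ← cos_two_pi_sub]
      congr 1; ring
    rw [e]
    have := mul_le_mul hc hz₃ hsq (by linarith)
    nlinarith
  have hsin : 0.9999 * (z - z ^ 3 / 6) - 0.0042586 ≤
      sin (2.972309866074 - z + 0.05523991 * π) := by
    have e : sin (2.972309866074 - z + 0.05523991 * π) =
        sin z * cos (2.972309866074 + 0.05523991 * π - π) -
          cos z * sin (2.972309866074 + 0.05523991 * π - π) := by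
      rw [← sin_sub, ← sin_pi_sub]
      congr 1; ring
    have h₂ : 0.9999 ≤ cos (2.972309866074 + 0.05523991 * π - π) := by
      refine le_trans ?_ one_sub_sq_div_two_le_cos
      nlinarith
    have h₃ : sin (2.972309866074 + 0.05523991 * π - π) ≤ 0.0042586 :=
      (sin_le (by linarith)).trans (by linarith)
    have h₄ : 0 ≤ sin (2.972309866074 + 0.05523991 * π - π) :=
      sin_nonneg_of_nonneg_of_le_pi (by linarith) (by linarith)
    rw [e]
    nlinarith [cos_le_one z]
  have hm := mul_le_mul_of_nonneg_left (add_le_add hsin hS) hz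
  -- polynomial lower bound for the growth of the slack from the end `z = 0`
  have hpoly : 0 ≤ z * (0.004 + 0.056 * z - 0.16665 * z ^ 3) := by
    apply mul_nonneg hz
    nlinarith [mul_nonneg hz (sub_nonneg.2 hz'), mul_nonneg (mul_nonneg hz hz) (sub_nonneg.2 hz')]
  nlinarith

/-- Finder between the cuts, partner on the arc after the second cut. The slack is smallest at the
left end, where the partner leaves the second cut. -/
theorem meeting_ineq_late_arc {x : ℝ} (h₀ : 2.972309866074 ≤ x) (h₁ : x ≤ 2.97374843355) :
    2 - 2 * cos (x + ((7.603423392574 + x) / 2 - 2.314118195774)) ≤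
      ((3.643376607426 - x) / 2) ^ 2 := by
  have hp := pi_gt_d20
  have hp' := pi_lt_d20
  obtain ⟨z, rfl⟩ : ∃ z, x = 2.972309866074 + z := ⟨x - 2.972309866074, by ring⟩
  have hz : 0 ≤ z := by linarith
  have hz' : z ≤ 0.00144 := by linarith
  have hc : 0.9437087 + 0.3 * z ≤ cos (0.3371270076 - 1.5 * z) := by
    have h₃ : 0.9437087 ≤ cos 0.3371270076 :=
      le_trans (by norm_num) (decic_le_cos (by norm_num))
    have h₄ : 0.33 ≤ sin 0.3371270076 := le_trans (by norm_num) (sin_ge_sub_cube (by norm_num))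
    have h₅ : 1 - (1.5 * z) ^ 2 / 2 ≤ cos (1.5 * z) := one_sub_sq_div_two_le_cos
    have h₆ : 1.5 * z - (1.5 * z) ^ 3 / 6 ≤ sin (1.5 * z) := sin_ge_sub_cube (by linarith)
    have h₈ : 0.9 * (1.5 * z) ≤ sin (1.5 * z) := by nlinarith
    have h₉ := mul_le_mul h₄ h₈ (by linarith) (by linarith)
    have h₁₀ := mul_le_mul h₃ h₅ (by nlinarith) (by linarith)
    rw [cos_sub]
    nlinarith
  have e : cos (2.972309866074 + z + ((7.603423392574 + (2.972309866074 + z)) / 2 -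
      2.314118195774)) = cos (2 * π - 5.946058299624 - 1.5 * z) := by
    rw [← cos_two_pi_sub]
    congr 1; ring
  have h₂ : cos (0.3371270076 - 1.5 * z) ≤ cos (2 * π - 5.946058299624 - 1.5 * z) :=
    cos_le_cos_of_nonneg_of_le_pi (by linarith) (by linarith) (by linarith)
  rw [e]
  nlinarith

/-- Finder at arc length `p₂ ≤ x ≤ π`, partner ahead on the final arc, possibly past the
antipode of the starting point. In terms of the arc `v` between the partner and the exit and the
flight time `t`, the chord of `v` is at most `t`. This is clear when `|v| ≤ t`, which fails only for
`x` very close to `p₂`; there the difference between chord and arc is what makes it true. -/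
theorem meeting_ineq_final_arc {x : ℝ} (h₀ : 2.97374843355 ≤ x) (h₁ : x ≤ π) :
    2 - 2 * cos (x + ((7.937518195774 + x) / 2 - 2.314118195774)) ≤
      ((3.309281804226 - x) / 2) ^ 2 := by
  have hp := pi_gt_d20
  have hp' := pi_lt_d20
  obtain ⟨t, ht⟩ : ∃ t, t = (3.309281804226 - x) / 2 := ⟨_, rfl⟩
  obtain ⟨v, hv⟩ : ∃ v, v = 2 * π - (x + ((7.937518195774 + x) / 2 - 2.314118195774)) := ⟨_, rfl⟩
  have e : cos (x + ((7.937518195774 + x) / 2 - 2.314118195774)) = cos v := by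
    rw [hv, cos_two_pi_sub]
  rw [e, ← ht]
  rcases le_total v t with h | h
  · have h₂ : 1 - v ^ 2 / 2 ≤ cos v := one_sub_sq_div_two_le_cos
    have h₃ : -t ≤ v := by linarith
    nlinarith
  · have hv₀ : 0.1676 ≤ v := by linarith
    have hv₁ : v ≤ 0.168 := by linarith
    have hd : v - t ≤ 0.000156 := by linarith
    have h₂ := sextic_le_cos (x := v) (by linarith)
    have h₃ : (0.1676 : ℝ) ^ 4 ≤ v ^ 4 := by gcongr
    have h₄ : v ^ 6 ≤ (0.168 : ℝ) ^ 6 := by gcongr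
    have h₅ : (v - t) * (v + t) ≤ 0.000156 * 0.336 :=
      mul_le_mul hd (by linarith) (by linarith) (by norm_num)
    norm_num at h₃ h₄ h₅
    nlinarith

/-! ### Geometry of arcs and cuts -/

@[simp] theorem arcPoint_re (x : ℝ) : (arcPoint x).re = cos x := Complex.exp_ofReal_mul_I_re x

@[simp] theorem arcPoint_im (x : ℝ) : (arcPoint x).im = sin x := Complex.exp_ofReal_mul_I_im x

@[simp] theorem cutDir_re (α : ℝ) : (cutDir α).re = sin α := by
  simp [cutDir, -Complex.ofReal_sin, -Complex.ofReal_cos]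

@[simp] theorem cutDir_im (α : ℝ) : (cutDir α).im = -cos α := by
  simp [cutDir, -Complex.ofReal_sin, -Complex.ofReal_cos]

theorem continuous_arcPoint : Continuous arcPoint := by unfold arcPoint; fun_prop

theorem arcPoint_zero : arcPoint 0 = 1 := by simp [arcPoint]

/-- Two robots on the circle, at arc lengths `x` and `y` in opposite directions, have squared distance
`2 - 2 cos (x + y)`. -/
theorem dist_arcPoint_conj_arcPoint_le {x y t : ℝ} (ht : 0 ≤ t)
    (h : 2 - 2 * cos (x + y) ≤ t ^ 2) :
    dist (arcPoint x) ((starRingEnd ℂ) (arcPoint y)) ≤ t := by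
  rw [Complex.dist_eq_re_im, Real.sqrt_le_iff]
  refine ⟨ht, le_trans (le_of_eq ?_) h⟩
  simp only [arcPoint_re, arcPoint_im, Complex.conj_re, Complex.conj_im, cos_add]
  linear_combination sin_sq_add_cos_sq x + sin_sq_add_cos_sq y

/-- The law of cosines for a robot on the circle and a robot at depth `r` in a mirrored cut. -/
theorem dist_arcPoint_conj_cut_le {x p α r t : ℝ} (ht : 0 ≤ t)
    (h : 2 - 2 * cos (x + p) - 2 * r * (sin (x + α) + sin (p - α)) + r ^ 2 ≤ t ^ 2) :
    dist (arcPoint x) ((starRingEnd ℂ) (arcPoint p + (r : ℂ) * cutDir α)) ≤ t := by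
  rw [Complex.dist_eq_re_im, Real.sqrt_le_iff]
  refine ⟨ht, le_trans (le_of_eq ?_) h⟩
  simp only [arcPoint_re, arcPoint_im, Complex.conj_re, Complex.conj_im, Complex.add_re,
    Complex.add_im, Complex.re_ofReal_mul, Complex.im_ofReal_mul, cutDir_re, cutDir_im, cos_add,
    sin_add, sin_sub]
  linear_combination sin_sq_add_cos_sq x + sin_sq_add_cos_sq p + r ^ 2 * sin_sq_add_cos_sq α

/-- A cut shorter than the chord `2 sin (p - α)` cut off by its line meets the circle only at its
starting point. -/
theorem norm_cut_ne_one {p α r : ℝ} (h₀ : 0 < r) (h₁ : r < 2 * sin (p - α)) :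
    ‖arcPoint p + (r : ℂ) * cutDir α‖ ≠ 1 := by
  intro h
  have h₂ : ‖arcPoint p + (r : ℂ) * cutDir α‖ ^ 2 = 1 - r * (2 * sin (p - α) - r) := by
    rw [Complex.sq_norm, Complex.normSq_apply]
    simp only [arcPoint_re, arcPoint_im, Complex.add_re,
      Complex.add_im, Complex.re_ofReal_mul, Complex.im_ofReal_mul, cutDir_re, cutDir_im, sin_sub]
    linear_combination sin_sq_add_cos_sq p + r ^ 2 * sin_sq_add_cos_sq α
  rw [h] at h₂
  nlinarith [mul_pos h₀ (sub_pos.2 h₁)]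

/-! ### The phases of the search trajectory -/

section phases

variable {P : CutParams} {s : ℝ}

theorem basePath_first_arc (h₀ : 1 ≤ s) (h₁ : s ≤ 1 + P.p₁) : basePath P s = arcPoint (s - 1) := by
  rcases h₀.eq_or_lt with rfl | h
  · simp [basePath, arcPoint_zero]
  · rw [basePath, if_neg h.not_ge, if_pos h₁]

theorem basePath_first_cut_in (hp : 0 < P.p₁) (h₀ : 1 + P.p₁ ≤ s) (h₁ : s ≤ 1 + P.p₁ + P.d₁) :
    basePath P s = arcPoint P.p₁ + ((s - (1 + P.p₁) : ℝ) : ℂ) * cutDir P.α₁ := by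
  rcases h₀.eq_or_lt with rfl | h
  · simp [basePath, hp]
  · rw [basePath, if_neg (by linarith), if_neg h.not_ge, if_pos h₁]

theorem basePath_first_cut_out (hp : 0 < P.p₁) (hd : 0 < P.d₁) (h₀ : 1 + P.p₁ + P.d₁ ≤ s)
    (h₁ : s ≤ 1 + P.p₁ + 2 * P.d₁) : basePath P s =
      arcPoint P.p₁ + ((1 + P.p₁ + 2 * P.d₁ - s : ℝ) : ℂ) * cutDir P.α₁ := by
  rcases h₀.eq_or_lt with rfl | h
  · rw [basePath_first_cut_in hp (by linarith) le_rfl]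
    congr 3; ring
  · rw [basePath, if_neg (by linarith), if_neg (by linarith), if_neg h.not_ge, if_pos h₁]

theorem basePath_middle_arc (hp : 0 < P.p₁) (hd : 0 < P.d₁) (h₀ : 1 + P.p₁ + 2 * P.d₁ ≤ s)
    (h₁ : s ≤ 1 + P.p₂ + 2 * P.d₁) : basePath P s = arcPoint (s - 1 - 2 * P.d₁) := by
  rcases h₀.eq_or_lt with rfl | h
  · rw [basePath_first_cut_out hp hd (by linarith) le_rfl, sub_self, Complex.ofReal_zero, zero_mul,
      add_zero]
    congr 1; ring
  · rw [basePath, if_neg (by linarith), if_neg (by linarith), if_neg (by linarith), if_neg h.not_ge,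
      if_pos h₁]

theorem basePath_second_cut_in (hp : 0 < P.p₁) (hd : 0 < P.d₁) (hp' : P.p₁ < P.p₂)
    (h₀ : 1 + P.p₂ + 2 * P.d₁ ≤ s) (h₁ : s ≤ 1 + P.p₂ + 2 * P.d₁ + P.d₂) : basePath P s =
      arcPoint P.p₂ + ((s - (1 + P.p₂ + 2 * P.d₁) : ℝ) : ℂ) * cutDir P.α₂ := by
  rcases h₀.eq_or_lt with rfl | h
  · rw [basePath_middle_arc hp hd (by linarith) le_rfl, sub_self, Complex.ofReal_zero, zero_mul,
      add_zero]
    congr 1; ring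
  · rw [basePath, if_neg (by linarith), if_neg (by linarith), if_neg (by linarith),
      if_neg (by linarith), if_neg h.not_ge, if_pos h₁]

theorem basePath_second_cut_out (hp : 0 < P.p₁) (hd : 0 < P.d₁) (hp' : P.p₁ < P.p₂)
    (hd' : 0 < P.d₂) (h₀ : 1 + P.p₂ + 2 * P.d₁ + P.d₂ ≤ s)
    (h₁ : s ≤ 1 + P.p₂ + 2 * P.d₁ + 2 * P.d₂) : basePath P s =
      arcPoint P.p₂ + ((1 + P.p₂ + 2 * P.d₁ + 2 * P.d₂ - s : ℝ) : ℂ) * cutDir P.α₂ := by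
  rcases h₀.eq_or_lt with rfl | h
  · rw [basePath_second_cut_in hp hd hp' (by linarith) le_rfl]
    congr 3; ring
  · rw [basePath, if_neg (by linarith), if_neg (by linarith), if_neg (by linarith),
      if_neg (by linarith), if_neg (by linarith), if_neg h.not_ge, if_pos h₁]

theorem basePath_final_arc (hp : 0 < P.p₁) (hd : 0 < P.d₁) (hp' : P.p₁ < P.p₂)
    (hd' : 0 < P.d₂) (h₀ : 1 + P.p₂ + 2 * P.d₁ + 2 * P.d₂ ≤ s) :
    basePath P s = arcPoint (s - 1 - 2 * P.d₁ - 2 * P.d₂) := by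
  rcases h₀.eq_or_lt with rfl | h
  · rw [basePath_second_cut_out hp hd hp' hd' (by linarith) le_rfl, sub_self, Complex.ofReal_zero,
      zero_mul, add_zero]
    congr 1; ring
  · rw [basePath, if_neg (by linarith), if_neg (by linarith), if_neg (by linarith),
      if_neg (by linarith), if_neg (by linarith), if_neg (by linarith), if_neg h.not_ge]

theorem continuous_basePath (hp : 0 < P.p₁) (hd : 0 < P.d₁) (hp' : P.p₁ < P.p₂)
    (hd' : 0 < P.d₂) : Continuous (basePath P) := by
  have ha : ∀ {f : ℝ → ℝ}, Continuous f → Continuous fun s => arcPoint (f s) :=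
    fun hf => continuous_arcPoint.comp hf
  unfold basePath
  refine Continuous.if_le (by fun_prop) ?_ (by fun_prop) (by fun_prop) ?_
  · refine Continuous.if_le (ha (by fun_prop)) ?_ (by fun_prop) (by fun_prop) ?_
    · refine Continuous.if_le (by fun_prop) ?_ (by fun_prop) (by fun_prop) ?_
      · refine Continuous.if_le (by fun_prop) ?_ (by fun_prop) (by fun_prop) ?_
        · refine Continuous.if_le (ha (by fun_prop)) ?_ (by fun_prop) (by fun_prop) ?_
          · refine Continuous.if_le (by fun_prop) ?_ (by fun_prop) (by fun_prop) ?_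
            · refine Continuous.if_le (by fun_prop) (ha (by fun_prop)) (by fun_prop)
                (by fun_prop) ?_
              rintro s rfl
              rw [sub_self, Complex.ofReal_zero, zero_mul, add_zero]
              congr 1; ring
            · rintro s rfl
              rw [if_pos (by linarith)]
              congr 3; ring
          · rintro s rfl
            rw [if_pos (by linarith), sub_self, Complex.ofReal_zero, zero_mul, add_zero]
            congr 1; ring
        · rintro s rfl
          rw [if_pos (by linarith), sub_self, Complex.ofReal_zero, zero_mul, add_zero]
          congr 1; ring
      · rintro s rfl
        rw [if_pos (by linarith)]
        congr 3; ring
    · rintro s rfl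
      rw [if_pos (by linarith), sub_self, Complex.ofReal_zero, zero_mul, add_zero]
      congr 1; ring
  · rintro s rfl
    rw [if_pos (by linarith), sub_self, arcPoint_zero, Complex.ofReal_one]

/-- The uninformed robot is on the circle only during the three arc phases. -/
theorem arc_phase_of_norm_basePath_eq_one (hp : 0 < P.p₁) (hd : 0 < P.d₁) (hp' : P.p₁ < P.p₂)
    (hd' : 0 < P.d₂) (h₁ : P.d₁ < 2 * sin (P.p₁ - P.α₁)) (h₂ : P.d₂ < 2 * sin (P.p₂ - P.α₂))
    (hs : 0 ≤ s) (h : ‖basePath P s‖ = 1) :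
    (1 ≤ s ∧ s ≤ 1 + P.p₁) ∨ (1 + P.p₁ + 2 * P.d₁ ≤ s ∧ s ≤ 1 + P.p₂ + 2 * P.d₁) ∨
      1 + P.p₂ + 2 * P.d₁ + 2 * P.d₂ ≤ s := by
  by_contra! hne
  obtain ⟨hn₁, hn₂, hn₃⟩ := hne
  rcases lt_or_ge s 1 with hs₁ | hs₁
  · rw [basePath, if_pos hs₁.le, Complex.norm_real, norm_of_nonneg hs] at h
    linarith
  have hs₂ := hn₁ hs₁
  rcases lt_or_ge s (1 + P.p₁ + 2 * P.d₁) with hs₃ | hs₃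
  · rcases le_total s (1 + P.p₁ + P.d₁) with hs₄ | hs₄
    · rw [basePath_first_cut_in hp hs₂.le hs₄] at h
      exact norm_cut_ne_one (by linarith) (by linarith) h
    · rw [basePath_first_cut_out hp hd hs₄ hs₃.le] at h
      exact norm_cut_ne_one (by linarith) (by linarith) h
  · have hs₄ := hn₂ hs₃
    rcases le_total s (1 + P.p₂ + 2 * P.d₁ + P.d₂) with hs₅ | hs₅
    · rw [basePath_second_cut_in hp hd hp' hs₄.le hs₅] at h
      exact norm_cut_ne_one (by linarith) (by linarith) h
    · rw [basePath_second_cut_out hp hd hp' hd' hs₅ hn₃.le] at h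
      exact norm_cut_ne_one (by linarith) (by linarith) h

/-- Every boundary point is visited, by one of the robots, before the robots have completed the
circle. -/
theorem exists_searchPath_eq (hp : 0 < P.p₁) (hd : 0 < P.d₁) (hp' : P.p₁ < P.p₂)
    (hd' : 0 < P.d₂) {u E : ℂ} (hu : ‖u‖ = 1) (hE : ‖E‖ = 1) :
    ∃ s, 0 ≤ s ∧ s ≤ 1 + π + 2 * P.d₁ + 2 * P.d₂ ∧ ∃ r, searchPath P u r s = E := by
  have hu₀ : u ≠ 0 := by
    rintro rfl
    simp at hu
  have hx : ∀ x : ℝ, 0 ≤ x → x ≤ π →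
      ∃ s, 0 ≤ s ∧ s ≤ 1 + π + 2 * P.d₁ + 2 * P.d₂ ∧ basePath P s = arcPoint x := by
    intro x hx₀ hx₁
    rcases le_total x P.p₁ with h | h
    · refine ⟨1 + x, by linarith, by linarith, ?_⟩
      rw [basePath_first_arc (by linarith) (by linarith)]
      congr 1; ring
    rcases le_total x P.p₂ with h' | h'
    · refine ⟨1 + x + 2 * P.d₁, by linarith, by linarith, ?_⟩
      rw [basePath_middle_arc hp hd (by linarith) (by linarith)]
      congr 1; ring
    · refine ⟨1 + x + 2 * P.d₁ + 2 * P.d₂, by linarith, by linarith, ?_⟩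
      rw [basePath_final_arc hp hd hp' hd' (by linarith)]
      congr 1; ring
  have hEu : arcPoint (E / u).arg = E / u := by
    have := Complex.norm_mul_exp_arg_mul_I (E / u)
    rwa [norm_div, hu, hE, div_one, Complex.ofReal_one, one_mul] at this
  rcases le_total 0 (E / u).arg with h | h
  · obtain ⟨s, hs₀, hs₁, hs⟩ := hx _ h (Complex.arg_le_pi _)
    refine ⟨s, hs₀, hs₁, .R1, ?_⟩
    rw [searchPath, hs, hEu, mul_div_cancel₀ _ hu₀]
  · obtain ⟨s, hs₀, hs₁, hs⟩ := hx (-(E / u).arg) (by linarith)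
      (by linarith [Complex.neg_pi_lt_arg (E / u)])
    refine ⟨s, hs₀, hs₁, .R2, ?_⟩
    have : (starRingEnd ℂ) (arcPoint (-(E / u).arg)) = arcPoint (E / u).arg := by
      apply Complex.ext <;> simp
    rw [searchPath, hs, this, hEu, mul_div_cancel₀ _ hu₀]

theorem continuous_searchPath (hP : Continuous (basePath P)) (u : ℂ) (r : Robot) :
    Continuous (searchPath P u r) := by
  cases r
  · exact continuous_const.mul hP
  · exact continuous_const.mul (Complex.continuous_conj.comp hP)

theorem norm_searchPath {u : ℂ} (hu : ‖u‖ = 1) (r : Robot) (s : ℝ) :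
    ‖searchPath P u r s‖ = ‖basePath P s‖ := by
  cases r <;> simp [searchPath, hu]

theorem dist_searchPath_other {u : ℂ} (hu : ‖u‖ = 1) (f : Robot) (s s' : ℝ) :
    dist (searchPath P u f s) (searchPath P u f.other s') =
      dist (basePath P s) ((starRingEnd ℂ) (basePath P s')) := by
  cases f
  · simp only [searchPath, Robot.other, dist_eq_norm, ← mul_sub, norm_mul, hu, one_mul]
  · simp only [searchPath, Robot.other, dist_eq_norm, ← mul_sub, norm_mul, hu, one_mul]
    rw [← Complex.norm_conj, map_sub, Complex.conj_conj]

end phases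

/-! ### The meeting protocol -/

theorem roundTrip_eq_exit {E M : ℂ} {t τ : ℝ} (ht : 0 ≤ t) (hτ : 2 * t ≤ τ) :
    roundTrip E M t τ = E := by
  unfold roundTrip
  split_ifs with h₁ h₂
  · have h₀ : t = 0 := by linarith
    simp [h₀]
  · have h₀ : t ≠ 0 := by
      rintro rfl
      exact h₁ (by linarith)
    have h₃ : τ = 2 * t := le_antisymm h₂ hτ
    have : (τ - t) / t = 1 := by
      rw [h₃]
      field_simp
      ring
    rw [this]
    simp
  · rfl

/-- Once the round trip of the finder is over, both robots are at the exit. -/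
theorem finderPos_partnerPos_eq_exit {P : CutParams} {u E : ℂ} {f : Robot} {t₀ t s : ℝ}
    (h : IsMeeting P u E f t₀ t) (hs : t₀ + 2 * t ≤ s) :
    finderPos P u E f t₀ t s = E ∧ partnerPos P u E f t₀ t s = E := by
  have ht : 0 ≤ t := h.pickup.1.1
  constructor
  · unfold finderPos
    split_ifs with h₁
    · rw [show s = t₀ by linarith, h.found]
    · exact roundTrip_eq_exit ht (by linarith)
  · unfold partnerPos
    split_ifs with h₁
    · have h₀ : t = 0 := by linarith
      have h₂ := h.pickup.1.2
      rw [show s = t₀ + t by linarith]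
      rw [h₀] at h₂ ⊢
      exact (dist_eq_zero.1 h₂).symm
    · exact roundTrip_eq_exit ht (by linarith)

/-- If at time `t₀ + τ` the partner is within distance `τ` of the exit, then the finder can pick it
up at time `t₀ + τ` or earlier. -/
theorem exists_pickup {g : ℝ → ℂ} (hg : Continuous g) {E : ℂ} {t₀ τ : ℝ} (hτ : 0 ≤ τ)
    (h : dist E (g (t₀ + τ)) ≤ τ) :
    ∃ t, t ≤ τ ∧ IsLeast {t : ℝ | 0 ≤ t ∧ dist E (g (t₀ + t)) = t} t := by
  have hc : Continuous fun t => t - dist E (g (t₀ + t)) := by fun_prop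
  obtain ⟨a, ha, ha'⟩ := intermediate_value_Icc hτ hc.continuousOn
    (show (0 : ℝ) ∈ Set.Icc _ _ from ⟨by simp [dist_nonneg], by linarith⟩)
  have hmem : a ∈ {t : ℝ | 0 ≤ t ∧ dist E (g (t₀ + t)) = t} :=
    ⟨ha.1, (sub_eq_zero.1 ha').symm⟩
  have hcl : IsClosed {t : ℝ | 0 ≤ t ∧ dist E (g (t₀ + t)) = t} :=
    (isClosed_le continuous_const continuous_id).inter (isClosed_eq (by fun_prop) continuous_id)
  have hbdd : BddBelow {t : ℝ | 0 ≤ t ∧ dist E (g (t₀ + t)) = t} := ⟨0, fun t ht => ht.1⟩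
  exact ⟨_, (csInf_le hbdd hmem).trans ha.2, hcl.csInf_mem ⟨a, hmem⟩ hbdd,
    fun t ht => csInf_le hbdd ht⟩

/-- Criterion for evacuation within time `T`: if the first discovery of an exit happens at time
`t₀`, then the finder and the partner can meet by time `(T + t₀) / 2`. -/
theorem evacuatesWithin_of_dist_le {P : CutParams} {u E : ℂ} {T b : ℝ}
    (hP : Continuous (basePath P)) (hu : ‖u‖ = 1) (hE : ‖E‖ = 1) (hbT : b ≤ T)
    (hb : ∃ s, 0 ≤ s ∧ s ≤ b ∧ ∃ r, searchPath P u r s = E)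
    (h : ∀ t₀, 0 ≤ t₀ → t₀ ≤ b → ‖basePath P t₀‖ = 1 →
      dist (basePath P t₀) ((starRingEnd ℂ) (basePath P ((T + t₀) / 2))) ≤ (T - t₀) / 2) :
    EvacuatesWithin P u E T := by
  obtain ⟨s₁, hs₁, hs₁b, r₁, hr₁⟩ := hb
  have hpick : ∀ f t₀, 0 ≤ t₀ → t₀ ≤ b → searchPath P u f t₀ = E → ∃ t, t ≤ (T - t₀) / 2 ∧
      IsLeast {τ : ℝ | 0 ≤ τ ∧ dist E (searchPath P u f.other (t₀ + τ)) = τ} t := by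
    intro f t₀ h₀ h₁ hf
    refine exists_pickup (continuous_searchPath hP u _) (by linarith) ?_
    rw [← hf, dist_searchPath_other hu, show t₀ + (T - t₀) / 2 = (T + t₀) / 2 by ring]
    exact h t₀ h₀ h₁ (by rw [← norm_searchPath hu f, hf, hE])
  refine ⟨?_, ?_⟩
  · have hcl : IsClosed {s : ℝ | 0 ≤ s ∧ ∃ r, searchPath P u r s = E} := by
      have : {s : ℝ | 0 ≤ s ∧ ∃ r, searchPath P u r s = E} =
          Set.Ici 0 ∩ ({s | searchPath P u .R1 s = E} ∪ {s | searchPath P u .R2 s = E}) := by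
        ext s
        constructor
        · rintro ⟨h₀, r, hr⟩
          cases r
          · exact ⟨h₀, Or.inl hr⟩
          · exact ⟨h₀, Or.inr hr⟩
        · rintro ⟨h₀, hr | hr⟩
          · exact ⟨h₀, _, hr⟩
          · exact ⟨h₀, _, hr⟩
      rw [this]
      exact isClosed_Ici.inter
        ((isClosed_eq (continuous_searchPath hP u _) continuous_const).union
          (isClosed_eq (continuous_searchPath hP u _) continuous_const))
    have hbdd : BddBelow {s : ℝ | 0 ≤ s ∧ ∃ r, searchPath P u r s = E} := ⟨0, fun s hs => hs.1⟩
    have hmem := hcl.csInf_mem ⟨s₁, hs₁, r₁, hr₁⟩ hbdd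
    have hle := csInf_le hbdd ⟨hs₁, r₁, hr₁⟩
    obtain ⟨h₀, f, hf⟩ := id hmem
    obtain ⟨t, -, ht⟩ := hpick f _ h₀ (hle.trans hs₁b) hf
    exact ⟨f, _, t, ⟨hmem, fun s hs => csInf_le hbdd hs⟩, hf, ht⟩
  · intro f t₀ t hm s hs
    obtain ⟨t', ht', hl⟩ := hpick f t₀ hm.first_discovery.1.1
      ((hm.first_discovery.2 ⟨hs₁, r₁, hr₁⟩).trans hs₁b) hm.found
    have : t ≤ t' := hm.pickup.2 hl.1
    exact finderPos_partnerPos_eq_exit hm (by linarith)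

/-! ### The optimized parameters -/

theorem starParams_first_cut_lt_chord :
    starParams.d₁ < 2 * sin (starParams.p₁ - starParams.α₁) := by
  have hS := le_sin_first_cut
  simp only [starParams]
  linarith

theorem starParams_second_cut_lt_chord :
    starParams.d₂ < 2 * sin (starParams.p₂ - starParams.α₂) := by
  have hS := le_sin_second_cut
  simp only [starParams]
  linarith

/-- The partner can be reached in time: at time `(5.6234 + t₀) / 2` it is close enough to the point
discovered at time `t₀`. The cases list the phases of the finder and of the partner. -/
theorem starParams_dist_partner_le {t₀ : ℝ} (h₀ : 0 ≤ t₀)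
    (h₁ : t₀ ≤ 1 + π + 2 * starParams.d₁ + 2 * starParams.d₂)
    (hn : ‖basePath starParams t₀‖ = 1) :
    dist (basePath starParams t₀)
      ((starRingEnd ℂ) (basePath starParams ((5.6234 + t₀) / 2))) ≤ (5.6234 - t₀) / 2 := by
  have hp := pi_lt_d20
  have hp₁ : (0 : ℝ) < starParams.p₁ := by norm_num [starParams]
  have hp₂ : starParams.p₁ < starParams.p₂ := by norm_num [starParams]
  have hd₁ : (0 : ℝ) < starParams.d₁ := by norm_num [starParams]
  have hd₂ : (0 : ℝ) < starParams.d₂ := by norm_num [starParams]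
  have e₁ : starParams.p₁ = 2.62666582851 := rfl
  have e₂ : starParams.p₂ = 2.97374843355 := rfl
  have e₃ : starParams.d₁ = 0.490011696287 := rfl
  have e₄ : starParams.d₂ = 0.1670474016 := rfl
  have e₅ : starParams.α₁ = 2 * π / 9 := rfl
  have e₆ : starParams.α₂ = 0.05523991 * π := rfl
  rw [e₃, e₄] at h₁
  have ht : 0 ≤ (5.6234 - t₀) / 2 := by linarith
  rcases arc_phase_of_norm_basePath_eq_one hp₁ hd₁ hp₂ hd₂ starParams_first_cut_lt_chord
    starParams_second_cut_lt_chord h₀ hn with ⟨h₂, h₃⟩ | ⟨h₂, h₃⟩ | h₂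
  · rw [basePath_first_arc h₂ h₃]
    rw [e₁] at h₃
    rcases le_total t₀ 1.62993165702 with c | c
    · rw [basePath_first_arc (by linarith) (by linarith)]
      apply dist_arcPoint_conj_arcPoint_le ht
      convert meeting_ineq_early_arc (x := t₀ - 1) (by linarith) (by linarith) using 1 <;> ring_nf
    rcases le_total t₀ 2.609955049594 with c' | c'
    · rw [basePath_first_cut_in hp₁ (by linarith) (by linarith)]
      apply dist_arcPoint_conj_cut_le ht
      rw [e₁, e₅]
      convert meeting_ineq_first_cut_in (x := t₀ - 1) (by linarith) (by linarith) using 1 <;>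
        ring_nf
    rcases le_total t₀ 3.589978442168 with c'' | c''
    · rw [basePath_first_cut_out hp₁ hd₁ (by linarith) (by linarith)]
      apply dist_arcPoint_conj_cut_le ht
      rw [e₁, e₃, e₅]
      convert meeting_ineq_first_cut_out (x := t₀ - 1) (by linarith) (by linarith) using 1 <;>
        ring_nf
    · rw [basePath_middle_arc hp₁ hd₁ (by linarith) (by linarith)]
      apply dist_arcPoint_conj_arcPoint_le ht
      rw [e₃]
      convert meeting_ineq_middle_arc (x := t₀ - 1) (by linarith) (by linarith) using 1 <;> ring_nf
  · rw [basePath_middle_arc hp₁ hd₁ h₂ h₃]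
    rw [e₁, e₃] at h₂
    rw [e₂, e₃] at h₃
    rcases le_total t₀ 4.618238455448 with c | c
    · rw [basePath_second_cut_in hp₁ hd₁ hp₂ (by linarith) (by linarith)]
      apply dist_arcPoint_conj_cut_le ht
      rw [e₂, e₃, e₆]
      convert meeting_ineq_second_cut_in (x := t₀ - 1.980023392574) (by linarith) (by linarith)
        using 1 <;> ring_nf
    rcases le_total t₀ 4.952333258648 with c' | c'
    · rw [basePath_second_cut_out hp₁ hd₁ hp₂ hd₂ (by linarith) (by linarith)]
      apply dist_arcPoint_conj_cut_le ht
      rw [e₂, e₃, e₄, e₆]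
      convert meeting_ineq_second_cut_out (x := t₀ - 1.980023392574) (by linarith) (by linarith)
        using 1 <;> ring_nf
    · rw [basePath_final_arc hp₁ hd₁ hp₂ hd₂ (by linarith)]
      apply dist_arcPoint_conj_arcPoint_le ht
      rw [e₃, e₄]
      convert meeting_ineq_late_arc (x := t₀ - 1.980023392574) (by linarith) (by linarith)
        using 1 <;> ring_nf
  · rw [basePath_final_arc hp₁ hd₁ hp₂ hd₂ h₂]
    rw [e₂, e₃, e₄] at h₂
    rw [basePath_final_arc hp₁ hd₁ hp₂ hd₂ (by linarith)]
    apply dist_arcPoint_conj_arcPoint_le ht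
    rw [e₃, e₄]
    convert meeting_ineq_final_arc (x := t₀ - 2.314118195774) (by linarith) (by linarith)
      using 1 <;> ring_nf

end DiskEvacuation

theorem mainTheorem1 (u E : ℂ) (hu : u ∈ Metric.sphere (0 : ℂ) 1)
    (hE : E ∈ Metric.sphere (0 : ℂ) 1) :
    DiskEvacuation.EvacuatesWithin DiskEvacuation.starParams u E 5.6234 := by
  open DiskEvacuation in
  have hp₁ : (0 : ℝ) < starParams.p₁ := by norm_num [starParams]
  have hp₂ : starParams.p₁ < starParams.p₂ := by norm_num [starParams]
  have hd₁ : (0 : ℝ) < starParams.d₁ := by norm_num [starParams]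
  have hd₂ : (0 : ℝ) < starParams.d₂ := by norm_num [starParams]
  have hu₁ : ‖u‖ = 1 := mem_sphere_zero_iff_norm.1 hu
  have hE₁ : ‖E‖ = 1 := mem_sphere_zero_iff_norm.1 hE
  refine evacuatesWithin_of_dist_le (continuous_basePath hp₁ hd₁ hp₂ hd₂) hu₁ hE₁ ?_
    (exists_searchPath_eq hp₁ hd₁ hp₂ hd₂ hu₁ hE₁) fun t₀ h₀ h₁ hn =>
      starParams_dist_partner_le h₀ h₁ hn
  have hp := Real.pi_lt_d20
  simp only [starParams]
  linarith
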